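/- Let $X$ and $Y$ be finite $T_0$-spaces. For a finite $T_0$-space $X$, order $X$ by $x\le y$ iff $x$ lies in every open set containing $y$, and let $\mathcal{K}(X)$ be the finite simplicial complex whose simplices are the non-empty chains of $X$. A continuous map $f:X\to Y$ is order preserving and induces a simplicial map $\mathcal{K}(f):\mathcal{K}(X)\to\mathcal{K}(Y)$, equal to $f$ on vertices, and hence a continuous map $|\mathcal{K}(f)|:|\mathcal{K}(X)|\to|\mathcal{K}(Y)|$ between the geometric realizations. For finite simplicial complexes $L\subseteq K$, there is an elementary collapse from $K$ to $L$ if there are a simplex $S$ of $K$ and a vertex $a\notin S$ of $K$ with $K=L\cup aS$ and $L\cap aS=a\dot S$, where $aS$ is the simplex spanned by $a$ and $S$ (with all its faces), $\dot S$ is the boundary of $S$ and $a\dot S$ is the cone on it with apex $a$; $K$ collapses to $L$ if there is a finite (possibly empty) sequence of elementary collapses from $K$ to $L$. An expansion is the map $|L|\to|K|$ induced by a simplicial isomorphism of $L$ onto a subcomplex to which $K$ collapses. A homotopy equivalence $g:|K|\to|L|$ between realizations of finite simplicial complexes is a simple homotopy equivalence if it is homotopic to a composition of a finite sequence of maps $|K|\to|K_1|\to\cdots\to|K_n|\to|L|$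 (all $K_i$ finite simplicial complexes), each of them an expansion or a homotopy inverse of one. Theorem. If $f:X\to Y$ is a homotopy equivalence between finite $T_0$-spaces, then $|\mathcal{K}(f)|:|\mathcal{K}(X)|\to|\mathcal{K}(Y)|$ is a simple homotopy equivalence. -/

import Mathlib

universe u v

namespace SimpleHomotopy

/-! ### Finite simplicial complexes and collapses

A finite simplicial complex is a `PreAbstractSimplicialComplex V` on a finite type `V`: a set of
non-empty finite subsets of `V` that is closed under passing to non-empty subsets.  Its vertices are
the `v : V` such that `{v}` is a face; they need not exhaust `V`. -/

/-- The complex formed by a simplex `S` and all its (non-empty) faces. -/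
def fullSimplex {V : Type u} (S : Finset V) : PreAbstractSimplicialComplex V where
  faces := {T | T.Nonempty ∧ T ⊆ S}
  isRelLowerSet_faces := fun _ hT => ⟨hT.1, fun _ hUT hU => ⟨hU, hUT.trans hT.2⟩⟩

/-- The boundary of a simplex `S`: all its (non-empty) proper faces. -/
def boundary {V : Type u} (S : Finset V) : PreAbstractSimplicialComplex V where
  faces := {T | T.Nonempty ∧ T ⊂ S}
  isRelLowerSet_faces := fun _ hT =>
    ⟨hT.1, fun _ hUT hU => ⟨hU, Finset.ssubset_of_subset_of_ssubset hUT hT.2⟩⟩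

open scoped Classical in
/-- The cone `aK` on `K` with apex `a` (used when `a` is not a vertex of `K`): its simplices are
`{a}`, the simplices `T` of `K`, and the sets `T ∪ {a}` with `T` a simplex of `K`. -/
noncomputable def cone {V : Type u} (a : V) (K : PreAbstractSimplicialComplex V) :
    PreAbstractSimplicialComplex V where
  faces := {T | T.Nonempty ∧ ((T.erase a).Nonempty → T.erase a ∈ K.faces)}
  isRelLowerSet_faces := fun _ hT =>
    ⟨hT.1, fun _ hUT hU => ⟨hU, fun hne =>
      (K.isRelLowerSet_faces (hT.2 (hne.mono (Finset.erase_subset_erase a hUT)))).2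
        (Finset.erase_subset_erase a hUT) hne⟩⟩

open scoped Classical in
/-- There is an elementary simplicial collapse from `K` to `L`: there are a simplex `S` of `K` and
a vertex `a` of `K` not in `S` with `K = L ∪ aS` and `L ∩ aS = a∂S`. -/
def ElementaryCollapse {V : Type u} (K L : PreAbstractSimplicialComplex V) : Prop :=
  ∃ (S : Finset V) (a : V), S ∈ K.faces ∧ {a} ∈ K.faces ∧ a ∉ S ∧
    K = L ⊔ fullSimplex (insert a S) ∧
    L ⊓ fullSimplex (insert a S) = cone a (boundary S)

/-- `K` collapses to `L`: there is a finite (possibly empty) sequence of elementary collapses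
from `K` to `L`. -/
def Collapses {V : Type u} (K L : PreAbstractSimplicialComplex V) : Prop :=
  Relation.ReflTransGen ElementaryCollapse K L

/-! ### Simplicial maps and geometric realization -/

open scoped Classical in
/-- A simplicial map: a map of vertices that sends simplices onto simplices. -/
structure SimplicialMap {V : Type u} {W : Type v} (K : PreAbstractSimplicialComplex V)
    (L : PreAbstractSimplicialComplex W) where
  toFun : V → W
  image_mem : ∀ S ∈ K.faces, S.image toFun ∈ L.faces

/-- The geometric realization `|K|` of a finite simplicial complex in barycentric coordinates:
the points of the standard simplex on `V` whose support is a simplex of `K`, with the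
subspace topology. -/
abbrev Realization {V : Type u} [Fintype V] (K : PreAbstractSimplicialComplex V) : Type u :=
  {t : stdSimplex ℝ V // Finset.univ.filter (fun v => t v ≠ 0) ∈ K.faces}

theorem support_map_mem {V : Type u} {W : Type v} [Fintype V] [Fintype W]
    {K : PreAbstractSimplicialComplex V} {L : PreAbstractSimplicialComplex W}
    (φ : SimplicialMap K L) (t : Realization K) :
    Finset.univ.filter (fun w => stdSimplex.map φ.toFun t.1 w ≠ 0) ∈ L.faces := by
  classical
  have key : Finset.univ.filter (fun w => stdSimplex.map φ.toFun t.1 w ≠ 0) =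
      (Finset.univ.filter (fun v => t.1 v ≠ 0)).image φ.toFun := by
    ext w
    simp only [Finset.mem_filter, Finset.mem_univ, true_and, Finset.mem_image,
      stdSimplex.map_coe, FunOnFinite.linearMap_apply_apply]
    have h0 := Finset.sum_eq_zero_iff_of_nonneg (s := Finset.univ.filter (fun v => φ.toFun v = w))
      (f := fun v => t.1 v) (fun v _ => t.1.2.1 v)
    refine (not_congr h0).trans ?_
    simp only [Finset.mem_filter, Finset.mem_univ, true_and]
    push Not
    exact ⟨fun ⟨v, h1, h2⟩ => ⟨v, h2, h1⟩, fun ⟨v, h1, h2⟩ => ⟨v, h2, h1⟩⟩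
  rw [key]
  convert! φ.image_mem _ t.2

/-- The map `|φ| : |K| → |L|` induced by a simplicial map `φ`: it is `φ` on vertices and
affine on every simplex. -/
noncomputable def SimplicialMap.realize {V : Type u} {W : Type v} [Fintype V] [Fintype W]
    {K : PreAbstractSimplicialComplex V} {L : PreAbstractSimplicialComplex W}
    (φ : SimplicialMap K L) : C(Realization K, Realization L) where
  toFun t := ⟨stdSimplex.map φ.toFun t.1, support_map_mem φ t⟩
  continuous_toFun :=
    ((stdSimplex.continuous_map φ.toFun).comp continuous_subtype_val).subtype_mk _

open scoped Classical in
/-- A simplicial map `φ : K → L` is a (simplicial) expansion if it is injective on the vertices of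
`K`, so that it identifies `K` with a subcomplex `φ(K)` of `L`, and `L` collapses to `φ(K)`. -/
def SimplicialMap.IsExpansion {V : Type u} {W : Type v} {K : PreAbstractSimplicialComplex V}
    {L : PreAbstractSimplicialComplex W} (φ : SimplicialMap K L) : Prop :=
  Set.InjOn φ.toFun {v | {v} ∈ K.faces} ∧ Collapses L (K.map φ.toFun)

/-! ### Simple homotopy equivalences -/

/-- `g` is a homotopy inverse of `f`. -/
def IsHomotopyInverse {A : Type u} {B : Type v} [TopologicalSpace A] [TopologicalSpace B]
    (f : C(A, B)) (g : C(B, A)) : Prop :=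
  (g.comp f).Homotopic (ContinuousMap.id A) ∧ (f.comp g).Homotopic (ContinuousMap.id B)

/-- `f` is a homotopy equivalence. -/
def IsHomotopyEquivalence {A : Type u} {B : Type v} [TopologicalSpace A] [TopologicalSpace B]
    (f : C(A, B)) : Prop :=
  ∃ g : C(B, A), IsHomotopyInverse f g

/-- The maps `|K| → |K₁| → ⋯ → |Kₙ| → |L|` which are compositions of finite sequences of maps, each
of them (the realization of) an expansion or a homotopy inverse of one. -/
inductive IsDeformation : ∀ {V W : Type u} [Fintype V] [Fintype W]
    {K : PreAbstractSimplicialComplex V} {L : PreAbstractSimplicialComplex W},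
    C(Realization K, Realization L) → Prop
  | expansion {V W : Type u} [Fintype V] [Fintype W]
      {K : PreAbstractSimplicialComplex V} {L : PreAbstractSimplicialComplex W}
      (φ : SimplicialMap K L) (hφ : φ.IsExpansion) : IsDeformation φ.realize
  | homotopyInverse {V W : Type u} [Fintype V] [Fintype W]
      {K : PreAbstractSimplicialComplex V} {L : PreAbstractSimplicialComplex W}
      (φ : SimplicialMap K L) (hφ : φ.IsExpansion) (r : C(Realization L, Realization K))
      (hr : IsHomotopyInverse φ.realize r) : IsDeformation r
  | comp {V W Z : Type u} [Fintype V] [Fintype W] [Fintype Z]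
      {K : PreAbstractSimplicialComplex V} {L : PreAbstractSimplicialComplex W}
      {M : PreAbstractSimplicialComplex Z}
      {f : C(Realization K, Realization L)} {g : C(Realization L, Realization M)}
      (hf : IsDeformation f) (hg : IsDeformation g) : IsDeformation (g.comp f)

/-- A map `f : |K| → |L|` is a simple homotopy equivalence if it is a homotopy equivalence that is
homotopic to a composition of finitely many expansions and homotopy inverses of expansions. -/
def IsSimpleHomotopyEquivalence {V W : Type u} [Fintype V] [Fintype W]
    {K : PreAbstractSimplicialComplex V} {L : PreAbstractSimplicialComplex W}
    (f : C(Realization K, Realization L)) : Prop :=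
  IsHomotopyEquivalence f ∧
    ∃ d : C(Realization K, Realization L), IsDeformation d ∧ f.Homotopic d

/-! ### The order complex of a finite T₀-space -/

/-- The complex `K(X)` of a finite T₀-space `X`: its simplices are the non-empty chains of `X` for
the order `x ≤ y ↔ x ∈ U_y`, where `U_y` is the intersection of all open sets containing `y`;
in Mathlib's notation `x ∈ U_y` reads `x ⤳ y`. -/
def orderComplex (X : Type u) [TopologicalSpace X] : PreAbstractSimplicialComplex X where
  faces := {S | S.Nonempty ∧ IsChain (fun x y : X => x ⤳ y) (S : Set X)}
  isRelLowerSet_faces := fun _ hS =>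
    ⟨hS.1, fun _ hTS hT => ⟨hT, hS.2.mono (Finset.coe_subset.2 hTS)⟩⟩

/-- The simplicial map `K(f) : K(X) → K(Y)` that coincides with `f` on vertices. -/
def orderComplexMap {X : Type u} {Y : Type v} [TopologicalSpace X] [TopologicalSpace Y]
    (f : C(X, Y)) : SimplicialMap (orderComplex X) (orderComplex Y) where
  toFun := f
  image_mem := by
    classical
    rintro S ⟨hne, hS⟩
    refine ⟨hne.image f, ?_⟩
    rintro _ hx _ hy hxy
    simp only [Finset.coe_image, Set.mem_image, Finset.mem_coe] at hx hy
    obtain ⟨x, hx, rfl⟩ := hx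
    obtain ⟨y, hy, rfl⟩ := hy
    have hne' : x ≠ y := fun h => hxy (congrArg f h)
    exact (hS hx hy hne').imp (fun h => h.map f.continuous) (fun h => h.map f.continuous)

end SimpleHomotopy

/-!
If the link of a vertex `x` of `K` is a cone with apex `p`, then the simplices that contain `x` but
not `p` can be cancelled one after the other, largest first, against their unions with `{p}`.  Hence
`K` collapses to the complex of the simplices that do not contain `x`.

A point `x` of a finite space is a beat point if the points other than `x` that lie below `x` have a
greatest element `p`, or dually.  Then every chain through `x` can be enlarged by `p`, so that the
link of `x` in `K(X)` is a cone with apex `p`, and moving `x` to `p` is a retraction that is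
homotopic to the identity of `X` and contiguous to it on `K(X)`.  So both spaces can be reduced
until no beat points are left.  Such a space is rigid: a map homotopic to the identity is the
identity.  The given homotopy equivalence has then become a homeomorphism.
-/

namespace SimpleHomotopy

section Collapse

variable {V : Type*}

/-- The deletion of a simplex `S` from `K`: the subcomplex of the simplices of `K` that do not have
`S` as a face.  For `S = {x}` it is the deletion of the vertex `x`. -/
def deletion (K : PreAbstractSimplicialComplex V) (S : Finset V) :
    PreAbstractSimplicialComplex V where
  faces := {T | T ∈ K.faces ∧ ¬ S ⊆ T}
  isRelLowerSet_faces := fun _ hT =>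
    ⟨(K.isRelLowerSet_faces hT.1).1, fun _ hUT hU =>
      ⟨K.isRelLowerSet_faces.mem_of_le hT.1 hUT hU, fun hSU => hT.2 (hSU.trans hUT)⟩⟩

variable {K : PreAbstractSimplicialComplex V}

theorem deletion_deletion_of_subset {R S : Finset V} (hRS : R ⊆ S) :
    deletion (deletion K S) R = deletion K R := by
  ext T
  exact ⟨fun hT => ⟨hT.1.1, hT.2⟩, fun hT => ⟨⟨hT.1, fun hST => hT.2 (hRS.trans hST)⟩, hT.2⟩⟩

open scoped Classical in
theorem elementaryCollapse_deletion_of_free {S : Finset V} {a : V} (haS : a ∉ S)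
    (hS : S ∈ K.faces) (haSK : insert a S ∈ K.faces)
    (hfree : ∀ T ∈ K.faces, S ⊆ T → T ⊆ insert a S) :
    ElementaryCollapse K (deletion K S) := by
  have face_of_subset {T : Finset V} (hT : T.Nonempty) (hTS : T ⊆ insert a S) : T ∈ K.faces :=
    K.isRelLowerSet_faces.mem_of_le haSK hTS hT
  refine ⟨S, a, hS, face_of_subset (Finset.singleton_nonempty a) (by simp), haS, ?_, ?_⟩
  · ext T
    constructor
    · intro hT
      by_cases hST : S ⊆ T
      · exact Or.inr ⟨(K.isRelLowerSet_faces hT).1, hfree T hT hST⟩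
      · exact Or.inl ⟨hT, hST⟩
    · rintro (hT | ⟨hT, hTS⟩)
      exacts [hT.1, face_of_subset hT hTS]
  · ext T
    have erase_ssubset_iff : T.erase a ⊂ S ↔ T ⊆ insert a S ∧ ¬ S ⊆ T := by
      rw [Finset.ssubset_def, Finset.subset_insert_iff, Finset.subset_erase, and_iff_left haS]
    constructor
    · rintro ⟨⟨-, hST⟩, hT, hTS⟩
      exact ⟨hT, fun hne => ⟨hne, erase_ssubset_iff.2 ⟨hTS, hST⟩⟩⟩
    · rintro ⟨hT, hTS⟩
      have hss : T.erase a ⊂ S := by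
        rcases (T.erase a).eq_empty_or_nonempty with hempty | hne
        · exact hempty ▸ (K.isRelLowerSet_faces hS).1.empty_ssubset
        · exact (hTS hne).2
      obtain ⟨hTS, hST⟩ := erase_ssubset_iff.1 hss
      exact ⟨⟨face_of_subset hT hTS, hST⟩, hT, hTS⟩

open scoped Classical in
/-- The vertex `x` of `K` is dominated by `p`: the link of `x` is a cone with apex `p`. -/
def IsDominatedBy (K : PreAbstractSimplicialComplex V) (x p : V) : Prop :=
  p ≠ x ∧ ∀ S ∈ K.faces, x ∈ S → insert p S ∈ K.faces

open scoped Classical in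
theorem IsDominatedBy.deletion {x p : V} {S : Finset V} (h : IsDominatedBy K x p) (hpS : p ∉ S) :
    IsDominatedBy (deletion K S) x p :=
  ⟨h.1, fun T hT hxT => ⟨h.2 T hT.1 hxT, by
    rw [Finset.subset_insert_iff_of_notMem hpS]
    exact hT.2⟩⟩

open scoped Classical in
theorem IsDominatedBy.collapses [Finite V] {x p : V} (h : IsDominatedBy K x p) :
    Collapses K (SimpleHomotopy.deletion K {x}) := by
  induction hn : K.faces.ncard using Nat.strong_induction_on generalizing K with
  | _ n ih =>
  by_cases hunpaired : ∃ S, S ∈ K.faces ∧ x ∈ S ∧ p ∉ S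
  · obtain ⟨S, ⟨hS, hxS, hpS⟩, hmax⟩ :=
      (Set.toFinite {S | S ∈ K.faces ∧ x ∈ S ∧ p ∉ S}).exists_maximal hunpaired
    have hfree : ∀ T ∈ K.faces, S ⊆ T → T ⊆ insert p S := by
      intro T hT hST
      have hSTp : S ⊆ T.erase p := Finset.subset_erase.2 ⟨hST, hpS⟩
      have hTp : T.erase p ∈ K.faces :=
        K.isRelLowerSet_faces.mem_of_le hT (Finset.erase_subset _ _) ⟨x, hSTp hxS⟩
      exact Finset.subset_insert_iff.2 (hmax ⟨hTp, hSTp hxS, Finset.notMem_erase p T⟩ hSTp)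
    have hlt : (SimpleHomotopy.deletion K S).faces.ncard < n :=
      hn ▸ Set.ncard_lt_ncard ⟨fun _ hT => hT.1, fun hle => (hle hS).2 subset_rfl⟩
    have hcollapse := ih _ hlt (h.deletion hpS) rfl
    rw [deletion_deletion_of_subset (Finset.singleton_subset_iff.2 hxS)] at hcollapse
    exact .head (elementaryCollapse_deletion_of_free hpS hS (h.2 S hS hxS) hfree) hcollapse
  · have hdel : SimpleHomotopy.deletion K {x} = K := by
      ext T
      refine ⟨fun hT => hT.1, fun hT => ⟨hT, fun hxT => hunpaired ⟨T.erase p, ?_⟩⟩⟩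
      have hxTp : x ∈ T.erase p :=
        Finset.mem_erase.2 ⟨h.1.symm, Finset.singleton_subset_iff.1 hxT⟩
      exact ⟨K.isRelLowerSet_faces.mem_of_le hT (Finset.erase_subset _ _) ⟨x, hxTp⟩, hxTp,
        Finset.notMem_erase p T⟩
    rw [hdel]
    exact .refl

end Collapse

section Contiguity

variable {V W A : Type*} [Fintype V] [Fintype W] [TopologicalSpace A]

/-- The carrier of a point of the standard simplex: the vertices at which its barycentric
coordinates do not vanish. -/
noncomputable def carrier (t : stdSimplex ℝ V) : Finset V :=
  Finset.univ.filter (fun v => t v ≠ 0)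

theorem mem_carrier {t : stdSimplex ℝ V} {v : V} : v ∈ carrier t ↔ t v ≠ 0 := by
  simp [carrier]

theorem carrier_nonempty (t : stdSimplex ℝ V) : (carrier t).Nonempty := by
  obtain ⟨v, -, hv⟩ := Finset.exists_ne_zero_of_sum_ne_zero
    (s := Finset.univ) (f := t) (by rw [stdSimplex.sum_eq_one]; exact one_ne_zero)
  exact ⟨v, mem_carrier.2 hv⟩

open scoped Classical in
theorem carrier_map_subset (φ : V → W) (t : stdSimplex ℝ V) :
    carrier (stdSimplex.map φ t) ⊆ (carrier t).image φ := by
  intro w hw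
  rw [mem_carrier, stdSimplex.map_coe, FunOnFinite.linearMap_apply_apply] at hw
  obtain ⟨v, hv, hne⟩ := Finset.exists_ne_zero_of_sum_ne_zero hw
  exact Finset.mem_image.2 ⟨v, mem_carrier.2 hne, (Finset.mem_filter.1 hv).2⟩

open scoped Classical in
theorem homotopic_of_carrier_union_mem {L : PreAbstractSimplicialComplex W}
    {f g : C(A, Realization L)} (h : ∀ a, carrier (f a).1 ∪ carrier (g a).1 ∈ L.faces) :
    f.Homotopic g := by
  let coords (k : C(A, Realization L)) : C(A, W → ℝ) :=
    ⟨fun a => (k a).1.1, by fun_prop⟩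
  let H := ContinuousMap.Homotopy.affine (coords f) (coords g)
  have hsimplex (q : unitInterval × A) : H q ∈ stdSimplex ℝ W :=
    (convex_stdSimplex ℝ W).lineMap_mem (f q.2).1.2 (g q.2).1.2 q.1.2
  have hcarrier (q : unitInterval × A) : carrier ⟨H q, hsimplex q⟩ ∈ L.faces := by
    refine L.isRelLowerSet_faces.mem_of_le (h q.2) (fun w hw => ?_) (carrier_nonempty _)
    rw [Finset.mem_union, mem_carrier, mem_carrier]
    by_contra! hzero
    refine mem_carrier.1 hw ?_
    change AffineMap.lineMap (coords f q.2) (coords g q.2) (q.1 : ℝ) w = 0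
    simp only [AffineMap.lineMap_apply_module, Pi.add_apply, Pi.smul_apply, smul_eq_mul]
    rw [show coords f q.2 w = 0 from hzero.1, show coords g q.2 w = 0 from hzero.2]
    simp
  exact ⟨{
    toFun q := ⟨⟨H q, hsimplex q⟩, hcarrier q⟩
    continuous_toFun := (H.continuous.subtype_mk _).subtype_mk _
    map_zero_left a := Subtype.ext (Subtype.ext (H.map_zero_left a))
    map_one_left a := Subtype.ext (Subtype.ext (H.map_one_left a)) }⟩

open scoped Classical in
/-- Two simplicial maps are contiguous if the images of every simplex lie in a common simplex. -/
def Contiguous {V W : Type*} {K : PreAbstractSimplicialComplex V}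
    {L : PreAbstractSimplicialComplex W} (φ ψ : SimplicialMap K L) : Prop :=
  ∀ S ∈ K.faces, S.image φ.toFun ∪ S.image ψ.toFun ∈ L.faces

theorem Contiguous.realize_homotopic {K : PreAbstractSimplicialComplex V}
    {L : PreAbstractSimplicialComplex W} {φ ψ : SimplicialMap K L} (h : Contiguous φ ψ) :
    φ.realize.Homotopic ψ.realize := by
  classical
  exact homotopic_of_carrier_union_mem fun t => L.isRelLowerSet_faces.mem_of_le (h _ t.2)
    (Finset.union_subset_union (carrier_map_subset _ _) (carrier_map_subset _ _))
    ((carrier_nonempty _).mono Finset.subset_union_left)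

end Contiguity

section HomotopyEquivalence

variable {A B C : Type*} [TopologicalSpace A] [TopologicalSpace B] [TopologicalSpace C]

theorem IsHomotopyInverse.symm {f : C(A, B)} {g : C(B, A)} (h : IsHomotopyInverse f g) :
    IsHomotopyInverse g f :=
  ⟨h.2, h.1⟩

theorem IsHomotopyEquivalence.comp {f : C(A, B)} {g : C(B, C)} (hg : IsHomotopyEquivalence g)
    (hf : IsHomotopyEquivalence f) : IsHomotopyEquivalence (g.comp f) := by
  obtain ⟨f', hf'⟩ := hf
  obtain ⟨g', hg'⟩ := hg
  let e : ContinuousMap.HomotopyEquiv A B := ⟨f, f', hf'.1, hf'.2⟩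
  let e' : ContinuousMap.HomotopyEquiv B C := ⟨g, g', hg'.1, hg'.2⟩
  exact ⟨f'.comp g', (e.trans e').left_inv, (e.trans e').right_inv⟩

theorem IsHomotopyEquivalence.of_homotopic {f g : C(A, B)} (hf : IsHomotopyEquivalence f)
    (h : f.Homotopic g) : IsHomotopyEquivalence g := by
  obtain ⟨f', hleft, hright⟩ := hf
  exact ⟨f', ((ContinuousMap.Homotopic.refl f').comp h.symm).trans hleft,
    (h.symm.comp (.refl f')).trans hright⟩

end HomotopyEquivalence

section SimpleHomotopyEquivalence

variable {U V W : Type u} [Fintype U] [Fintype V] [Fintype W]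
  {K : PreAbstractSimplicialComplex U} {L : PreAbstractSimplicialComplex V}
  {M : PreAbstractSimplicialComplex W}

theorem IsSimpleHomotopyEquivalence.comp {f : C(Realization K, Realization L)}
    {g : C(Realization L, Realization M)} (hg : IsSimpleHomotopyEquivalence g)
    (hf : IsSimpleHomotopyEquivalence f) : IsSimpleHomotopyEquivalence (g.comp f) := by
  obtain ⟨hf, d, hd, hfd⟩ := hf
  obtain ⟨hg, e, he, hge⟩ := hg
  exact ⟨hg.comp hf, _, .comp hd he, hge.comp hfd⟩

theorem IsSimpleHomotopyEquivalence.of_homotopic {f g : C(Realization K, Realization L)}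
    (hf : IsSimpleHomotopyEquivalence f) (h : f.Homotopic g) : IsSimpleHomotopyEquivalence g := by
  obtain ⟨hf, d, hd, hfd⟩ := hf
  exact ⟨hf.of_homotopic h, d, hd, h.symm.trans hfd⟩

theorem IsSimpleHomotopyEquivalence.of_comp_right {f : C(Realization L, Realization M)}
    {i : C(Realization K, Realization L)} {r : C(Realization L, Realization K)}
    (hfi : IsSimpleHomotopyEquivalence (f.comp i)) (hr : IsSimpleHomotopyEquivalence r)
    (hir : (i.comp r).Homotopic (.id _)) : IsSimpleHomotopyEquivalence f :=
  (hfi.comp hr).of_homotopic ((ContinuousMap.Homotopic.refl f).comp hir)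

theorem IsSimpleHomotopyEquivalence.of_comp_left {f : C(Realization K, Realization M)}
    {i : C(Realization L, Realization M)} {r : C(Realization M, Realization L)}
    (hrf : IsSimpleHomotopyEquivalence (r.comp f)) (hi : IsSimpleHomotopyEquivalence i)
    (hir : (i.comp r).Homotopic (.id _)) : IsSimpleHomotopyEquivalence f :=
  (hi.comp hrf).of_homotopic (hir.comp (.refl f))

end SimpleHomotopyEquivalence

section OrderComplex

theorem realize_orderComplexMap_id (X : Type*) [Fintype X] [TopologicalSpace X] :
    (orderComplexMap (ContinuousMap.id X)).realize = ContinuousMap.id _ :=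
  ContinuousMap.ext fun t => Subtype.ext (stdSimplex.map_id_apply t.1)

theorem realize_orderComplexMap_comp {X Y Z : Type*} [Fintype X] [Fintype Y] [Fintype Z]
    [TopologicalSpace X] [TopologicalSpace Y] [TopologicalSpace Z] (g : C(Y, Z)) (f : C(X, Y)) :
    (orderComplexMap (g.comp f)).realize =
      (orderComplexMap g).realize.comp (orderComplexMap f).realize :=
  ContinuousMap.ext fun t => Subtype.ext (stdSimplex.map_comp_apply f g t.1).symm

open scoped Classical in
theorem mem_faces_map_orderComplex {X Y : Type*} [TopologicalSpace X] [TopologicalSpace Y]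
    {i : X → Y} (hi : Topology.IsInducing i) {T : Finset Y} :
    T ∈ ((orderComplex X).map i).faces ↔
      T ∈ (orderComplex Y).faces ∧ (T : Set Y) ⊆ Set.range i := by
  constructor
  · rintro ⟨S, hS, rfl⟩
    exact ⟨(orderComplexMap ⟨i, hi.continuous⟩).image_mem S hS, by simp⟩
  · rintro ⟨⟨hne, hT⟩, hrange⟩
    obtain ⟨S, -, rfl⟩ := Finset.subset_set_image_iff.1 (Set.image_univ ▸ hrange)
    refine ⟨S, ⟨Finset.image_nonempty.1 hne, fun a ha b hb _ => ?_⟩, rfl⟩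
    simp only [← hi.specializes_iff]
    have : Std.Refl fun y y' : Y => y ⤳ y' := ⟨specializes_refl⟩
    exact hT.total (Finset.mem_image_of_mem i ha) (Finset.mem_image_of_mem i hb)

theorem isSimpleHomotopyEquivalence_realize_homeomorph {X Y : Type u} [Fintype X] [Fintype Y]
    [TopologicalSpace X] [TopologicalSpace Y] (e : X ≃ₜ Y) :
    IsSimpleHomotopyEquivalence (orderComplexMap (e : C(X, Y))).realize := by
  classical
  have hmap : (orderComplex X).map e = orderComplex Y := by
    ext T
    simp [mem_faces_map_orderComplex e.isInducing, e.surjective.range_eq]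
  have hexp : (orderComplexMap (e : C(X, Y))).IsExpansion := by
    have hcollapse : Collapses (orderComplex Y) ((orderComplex X).map e) := hmap ▸ .refl
    exact ⟨e.injective.injOn, hcollapse⟩
  refine ⟨⟨(orderComplexMap (e.symm : C(Y, X))).realize, ?_, ?_⟩, _, .expansion _ hexp, .refl _⟩
  · rw [← realize_orderComplexMap_comp, e.symm_comp_toContinuousMap, realize_orderComplexMap_id]
  · rw [← realize_orderComplexMap_comp, e.toContinuousMap_comp_symm, realize_orderComplexMap_id]

end OrderComplex

section DownBeatPoint

variable {α : Type*} [Preorder α] {x p : α}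

/-- `x` is a down beat point of a preorder, witnessed by `p`: among the elements below `x`
and different from `x`, there is a greatest one, namely `p`. -/
def IsDownBeatPoint (x p : α) : Prop :=
  IsGreatest (Set.Iic x \ {x}) p

theorem IsDownBeatPoint.isChain_insert {s : Set α} (h : IsDownBeatPoint x p)
    (hs : IsChain (· ≤ ·) s) (hx : x ∈ s) : IsChain (· ≤ ·) (insert p s) := by
  refine hs.insert fun y hy _ => ?_
  rcases eq_or_ne y x with rfl | hyx
  · exact Or.inl h.1.1
  · rcases hs hy hx hyx with hle | hle
    · exact Or.inr (h.2 ⟨hle, hyx⟩)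
    · exact Or.inl (h.1.1.trans hle)

theorem IsDownBeatPoint.update_id_le [DecidableEq α] (h : IsDownBeatPoint x p) (y : α) :
    Function.update id x p y ≤ y := by
  rcases eq_or_ne y x with rfl | hyx
  · simpa using h.1.1
  · simp [hyx]

theorem IsDownBeatPoint.monotone_update_id [DecidableEq α] (h : IsDownBeatPoint x p) :
    Monotone (Function.update id x p) := by
  intro a b hab
  rcases eq_or_ne b x with rfl | hb
  · rcases eq_or_ne a b with rfl | ha
    · exact le_rfl
    · simpa [ha] using h.2 ⟨hab, ha⟩
  · rw [Function.update_of_ne hb]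
    exact (h.update_id_le a).trans hab

theorem eq_id_of_monotone_of_le_of_forall_not_isDownBeatPoint [WellFoundedLT α]
    (hα : ∀ x p : α, ¬ IsDownBeatPoint x p) {h : α → α} (hmono : Monotone h)
    (hle : ∀ x, h x ≤ x) : h = id := by
  funext x
  induction x using WellFoundedLT.induction with
  | _ x ih =>
  by_contra hx
  refine hα x (h x) ⟨⟨hle x, hx⟩, fun y ⟨hyx, hne⟩ => ?_⟩
  have hlt : y < x :=
    lt_of_le_not_ge hyx fun hxy => hα x y ⟨⟨hyx, hne⟩, fun z hz => le_trans hz.1 hxy⟩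
  exact (ih y hlt).ge.trans (hmono hyx)

end DownBeatPoint

section FiniteSpace

variable {X Y : Type*} [TopologicalSpace X] [TopologicalSpace Y]

theorem continuous_of_specializes [AlexandrovDiscrete X] {f : X → Y}
    (h : ∀ a b, a ⤳ b → f a ⤳ f b) : Continuous f :=
  ⟨fun _ hU => isOpen_iff_forall_specializes.2 fun a b hab hb => (h a b hab).mem_open hU hb⟩

open scoped Classical in
theorem homotopic_of_specializes {f g : C(X, Y)} (h : ∀ x, f x ⤳ g x) : f.Homotopic g := by
  refine ⟨{
    toFun := fun q => if q.1 < 1 then f q.2 else g q.2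
    continuous_toFun := ⟨fun U hU => ?_⟩
    map_zero_left := fun x => by simp
    map_one_left := fun x => by simp }⟩
  have hpre : (fun q : unitInterval × X => if q.1 < 1 then f q.2 else g q.2) ⁻¹' U =
      Prod.snd ⁻¹' (g ⁻¹' U) ∪ (Prod.fst ⁻¹' Set.Iio 1 ∩ Prod.snd ⁻¹' (f ⁻¹' U)) := by
    ext ⟨s, x⟩
    by_cases hs : s < 1
    · have hgf : g x ∈ U → f x ∈ U := (h x).mem_open hU
      simpa [hs] using hgf
    · simp [hs]
  rw [hpre]
  exact ((hU.preimage g.continuous).preimage continuous_snd).union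
    ((isOpen_Iio.preimage continuous_fst).inter
      ((hU.preimage f.continuous).preimage continuous_snd))

theorem eventually_forall_specializes {T : Type*} [TopologicalSpace T] [Finite X]
    [AlexandrovDiscrete Y] (H : C(T × X, Y)) (t : T) :
    ∀ᶠ s in nhds t, ∀ x, H (s, x) ⤳ H (t, x) := by
  refine Filter.eventually_all.2 fun x => ?_
  have hc : ContinuousAt (fun s => H (s, x)) t := by fun_prop
  filter_upwards [hc.eventually_mem (nhdsKer_singleton_subset_iff_mem_nhds.1 subset_rfl)] with s hs
  exact mem_nhdsKer_singleton.1 hs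

/-- `x` is a beat point of a space, witnessed by `p`: a down beat point for the specialization
preorder or for its dual.  The definition does not depend on the direction chosen for the
specialization preorder. -/
def IsBeatPoint (x p : X) : Prop :=
  letI := specializationPreorder X
  IsDownBeatPoint x p ∨ IsDownBeatPoint (OrderDual.toDual x) (OrderDual.toDual p)

theorem eq_id_of_homotopic_id [Finite X] (hX : ∀ x p : X, ¬ IsBeatPoint x p) {h : C(X, X)}
    (hh : h.Homotopic (ContinuousMap.id X)) : h = ContinuousMap.id X := by
  have hdown (k : C(X, X)) (hk : ∀ x, x ⤳ k x) (x : X) : k x = x :=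
    letI := specializationPreorder X
    congrFun (eq_id_of_monotone_of_le_of_forall_not_isDownBeatPoint
      (fun x p hp => hX x p (Or.inl hp)) k.continuous.specialization_monotone hk) x
  have hup (k : C(X, X)) (hk : ∀ x, k x ⤳ x) (x : X) : k x = x :=
    letI := specializationPreorder X
    congrFun (eq_id_of_monotone_of_le_of_forall_not_isDownBeatPoint (α := Xᵒᵈ)
      (fun x p hp => hX x p (Or.inr hp)) k.continuous.specialization_monotone.dual hk) x
  obtain ⟨H⟩ := hh
  -- For `s` near `t`, the maps `H s` and `H t` are comparable; so if one is the identity, then so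
  -- is the other.
  have hclopen : IsClopen {t : unitInterval | ∀ x, H (t, x) = x} := by
    constructor
    · refine isOpen_compl_iff.1 (isOpen_iff_mem_nhds.2 fun t ht => ?_)
      filter_upwards [eventually_forall_specializes H.toContinuousMap t] with s hst hs
      exact ht (hdown (H.curry t) fun x => by simpa [hs x] using hst x)
    · refine isOpen_iff_mem_nhds.2 fun t ht => ?_
      filter_upwards [eventually_forall_specializes H.toContinuousMap t] with s hst
      exact hup (H.curry s) fun x => by simpa [ht x] using hst x
  have hzero : (0 : unitInterval) ∈ {t : unitInterval | ∀ x, H (t, x) = x} :=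
    hclopen.eq_univ ⟨1, fun x => by simp⟩ ▸ Set.mem_univ _
  ext x
  simpa using hzero x

end FiniteSpace

section BeatPoint

variable {X : Type*} [TopologicalSpace X] {x p : X}

open scoped Classical in
theorem IsBeatPoint.isDominatedBy (h : IsBeatPoint x p) : IsDominatedBy (orderComplex X) x p := by
  let := specializationPreorder X
  refine ⟨h.elim (fun h => h.1.2) (fun h => h.1.2), fun S ⟨_, hS⟩ hx =>
    ⟨Finset.insert_nonempty _ _, ?_⟩⟩
  rw [Finset.coe_insert]
  rcases h with h | h
  · exact (h.isChain_insert hS.symm hx).symm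
  · exact h.isChain_insert hS hx

open scoped Classical in
theorem IsBeatPoint.continuous_update_id [AlexandrovDiscrete X] (h : IsBeatPoint x p) :
    Continuous (Function.update id x p) := by
  let := specializationPreorder X
  refine continuous_of_specializes fun a b hab => ?_
  rcases h with h | h
  · exact h.monotone_update_id hab
  · exact h.monotone_update_id hab

/-- The inclusion of the complement of the point `x`. -/
def inclusion (x : X) : C({y : X // y ≠ x}, X) :=
  ⟨Subtype.val, continuous_subtype_val⟩

open scoped Classical in
theorem IsBeatPoint.update_id_ne (h : IsBeatPoint x p) (y : X) : Function.update id x p y ≠ x := by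
  rcases eq_or_ne y x with rfl | hyx
  · rw [Function.update_self]
    exact h.isDominatedBy.1
  · rwa [Function.update_of_ne hyx]

open scoped Classical in
/-- The retraction onto the complement of a beat point `x` that moves `x` to `p`. -/
noncomputable def IsBeatPoint.retraction [AlexandrovDiscrete X] (h : IsBeatPoint x p) :
    C(X, {y : X // y ≠ x}) where
  toFun y := ⟨Function.update id x p y, h.update_id_ne y⟩
  continuous_toFun := h.continuous_update_id.subtype_mk _

open scoped Classical in
theorem map_inclusion (x : X) :
    (orderComplex {y : X // y ≠ x}).map (inclusion x) = deletion (orderComplex X) {x} := by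
  ext T
  refine (mem_faces_map_orderComplex Topology.IsInducing.subtypeVal).trans
    (and_congr_right fun _ => ?_)
  rw [Finset.singleton_subset_iff]
  constructor
  · intro hT hx
    obtain ⟨y, hy⟩ := hT hx
    exact y.2 hy
  · exact fun hx y hy => ⟨⟨y, fun hyx => hx (hyx ▸ hy)⟩, rfl⟩

theorem IsBeatPoint.isExpansion_inclusion [Finite X] (h : IsBeatPoint x p) :
    (orderComplexMap (inclusion x)).IsExpansion := by
  classical
  refine ⟨Subtype.val_injective.injOn, ?_⟩
  have hcollapse := h.isDominatedBy.collapses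
  rw [← map_inclusion] at hcollapse
  exact hcollapse

section Retraction

variable [AlexandrovDiscrete X]

theorem IsBeatPoint.retraction_comp_inclusion (h : IsBeatPoint x p) :
    h.retraction.comp (inclusion x) = ContinuousMap.id _ := by
  classical
  ext y
  exact Function.update_of_ne y.2 p id

theorem IsBeatPoint.isHomotopyInverse (h : IsBeatPoint x p) :
    IsHomotopyInverse (inclusion x) h.retraction := by
  classical
  let := specializationPreorder X
  refine ⟨by rw [h.retraction_comp_inclusion], ?_⟩
  rcases id h with hdown | hup
  · exact (homotopic_of_specializes hdown.update_id_le).symm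
  · exact homotopic_of_specializes hup.update_id_le

theorem IsBeatPoint.contiguous_id (h : IsBeatPoint x p) :
    Contiguous (orderComplexMap ((inclusion x).comp h.retraction))
      (orderComplexMap (ContinuousMap.id X)) := by
  classical
  intro S hS
  have face_of_superset {T : Finset X} (hT : T ∈ (orderComplex X).faces) (hST : S ⊆ T)
      (hp : x ∈ S → p ∈ T) : S.image (Function.update id x p) ∪ S.image id ∈
        (orderComplex X).faces := by
    refine (orderComplex X).isRelLowerSet_faces.mem_of_le hT ?_
      ((hS.1.image _).mono Finset.subset_union_left)
    rw [Finset.image_id]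
    refine Finset.union_subset (Finset.image_subset_iff.2 fun y hy => ?_) hST
    rcases eq_or_ne y x with rfl | hyx
    · simpa using hp hy
    · simpa [hyx] using hST hy
  by_cases hx : x ∈ S
  · exact face_of_superset (h.isDominatedBy.2 S hS hx) (Finset.subset_insert p S)
      fun _ => Finset.mem_insert_self p S
  · exact face_of_superset hS subset_rfl fun hx' => absurd hx' hx

end Retraction

theorem IsBeatPoint.isHomotopyInverse_realize [Fintype X] [Fintype {y : X // y ≠ x}]
    (h : IsBeatPoint x p) :
    IsHomotopyInverse (orderComplexMap (inclusion x)).realize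
      (orderComplexMap h.retraction).realize := by
  constructor
  · rw [← realize_orderComplexMap_comp, h.retraction_comp_inclusion, realize_orderComplexMap_id]
  · rw [← realize_orderComplexMap_comp, ← realize_orderComplexMap_id]
    exact h.contiguous_id.realize_homotopic

end BeatPoint

section Removal

variable {X Y : Type u} [Fintype X] [Fintype Y] [TopologicalSpace X] [TopologicalSpace Y]

theorem IsBeatPoint.isSimpleHomotopyEquivalence_inclusion {x p : X} [Fintype {y : X // y ≠ x}]
    (h : IsBeatPoint x p) :
    IsSimpleHomotopyEquivalence (orderComplexMap (inclusion x)).realize :=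
  ⟨⟨_, h.isHomotopyInverse_realize⟩, _, .expansion _ h.isExpansion_inclusion, .refl _⟩

theorem IsBeatPoint.isSimpleHomotopyEquivalence_retraction {x p : X} [Fintype {y : X // y ≠ x}]
    (h : IsBeatPoint x p) :
    IsSimpleHomotopyEquivalence (orderComplexMap h.retraction).realize :=
  ⟨⟨_, h.isHomotopyInverse_realize.symm⟩, _,
    .homotopyInverse _ h.isExpansion_inclusion _ h.isHomotopyInverse_realize, .refl _⟩

theorem IsBeatPoint.isSimpleHomotopyEquivalence_of_comp_inclusion {x p : X}
    [Fintype {y : X // y ≠ x}] (h : IsBeatPoint x p) {f : C(X, Y)}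
    (hf : IsSimpleHomotopyEquivalence (orderComplexMap (f.comp (inclusion x))).realize) :
    IsSimpleHomotopyEquivalence (orderComplexMap f).realize := by
  rw [realize_orderComplexMap_comp] at hf
  exact hf.of_comp_right h.isSimpleHomotopyEquivalence_retraction h.isHomotopyInverse_realize.2

theorem IsBeatPoint.isSimpleHomotopyEquivalence_of_retraction_comp {y p : Y}
    [Fintype {z : Y // z ≠ y}] (h : IsBeatPoint y p) {f : C(X, Y)}
    (hf : IsSimpleHomotopyEquivalence (orderComplexMap (h.retraction.comp f)).realize) :
    IsSimpleHomotopyEquivalence (orderComplexMap f).realize := by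
  rw [realize_orderComplexMap_comp] at hf
  exact hf.of_comp_left h.isSimpleHomotopyEquivalence_inclusion h.isHomotopyInverse_realize.2

end Removal

end SimpleHomotopy

open SimpleHomotopy in
theorem mainTheorem5_general {X Y : Type u} [Fintype X] [Fintype Y] [TopologicalSpace X]
    [TopologicalSpace Y] (f : C(X, Y)) (hf : IsHomotopyEquivalence f) :
    IsSimpleHomotopyEquivalence (orderComplexMap f).realize := by
  classical
  induction hn : Fintype.card X + Fintype.card Y using Nat.strong_induction_on
    generalizing X Y with
  | _ n ih =>
  by_cases hX : ∃ x p : X, IsBeatPoint x p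
  · obtain ⟨x, p, hx⟩ := hX
    have hcard : Fintype.card {y : X // y ≠ x} < Fintype.card X :=
      Fintype.card_subtype_lt (x := x) (by simp)
    exact hx.isSimpleHomotopyEquivalence_of_comp_inclusion
      (ih _ (by omega) _ (hf.comp ⟨_, hx.isHomotopyInverse⟩) rfl)
  by_cases hY : ∃ y p : Y, IsBeatPoint y p
  · obtain ⟨y, p, hy⟩ := hY
    have hcard : Fintype.card {z : Y // z ≠ y} < Fintype.card Y :=
      Fintype.card_subtype_lt (x := y) (by simp)
    exact hy.isSimpleHomotopyEquivalence_of_retraction_comp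
      (ih _ (by omega) _ (.comp ⟨_, hy.isHomotopyInverse.symm⟩ hf) rfl)
  push Not at hX hY
  obtain ⟨g, hgf, hfg⟩ := hf
  have hleft : g.comp f = .id X := eq_id_of_homotopic_id hX hgf
  have hright : f.comp g = .id Y := eq_id_of_homotopic_id hY hfg
  exact isSimpleHomotopyEquivalence_realize_homeomorph
    { toFun := f, invFun := g, left_inv := DFunLike.congr_fun hleft,
      right_inv := DFunLike.congr_fun hright }

theorem mainTheorem5 {X Y : Type u} [Fintype X] [Fintype Y] [TopologicalSpace X]
    [TopologicalSpace Y] [T0Space X] [T0Space Y] (f : C(X, Y))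
    (hf : SimpleHomotopy.IsHomotopyEquivalence f) :
    SimpleHomotopy.IsSimpleHomotopyEquivalence (SimpleHomotopy.orderComplexMap f).realize :=
  mainTheorem5_general f hf
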